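/- Notation. For positive integers $n,k$ let $s(n,k)$ be the (unsigned) Stirling number of the first kind, i.e. the number of permutations of $n$ elements with exactly $k$ disjoint cycles; equivalently $x(x+1)\cdots(x+n-1)=\sum_{k=0}^{n}s(n,k)x^k$. Let $v_p$ denote the $p$-adic valuation on the rational numbers, and let $B_n$ be the $n$-th Bernoulli number, $\frac{x}{e^x-1}=\sum_{n\ge 0}B_n\frac{x^n}{n!}$. For an integer $k$ put $\epsilon_k:=0$ if $k$ is even and $\epsilon_k:=1$ if $k$ is odd, and let $\langle k\rangle$ be the integer with $0\le\langle k\rangle\le p-2$ and $k\equiv\langle k\rangle \pmod{p-1}$. A prime $p\ge 5$ is called regular if $v_p(B_l)=0$ for all even integers $l$ with $2\le l\le p-3$. Theorem. Let $p\ge 5$ be a prime and let $a$ and $k$ be integers such that $1\le a\le p-1$ and $2\le k\le ap-2$. Then each of the following is true. (i) If $k\equiv\epsilon_k\pmod{p-1}$, then $v_p(s(ap,ap-k))=(v_p(k)+1)\epsilon_k$. (ii) If $2\le k\le a(p-1)-1$ and $k\not\equiv\epsilon_k\pmod{p-1}$, then $$v_p(s(ap,ap-k))\ge (v_p(k)+1)\epsilon_k+1,$$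 with equality if and only if $v_p\big(B_{2\lfloor\langle k\rangle/2\rfloor}\big)=0$. In particular, if $p$ is regular, then $v_p(s(ap,ap-k))=(v_p(k)+1)\epsilon_k+1$. (iii) If $a\ge 4$ and $a(p-1)+2\le k\le ap-2$, then $v_p(s(ap,ap-k))\ge a+k-ap$. -/

import Mathlib

namespace StirlingValuation

/-- `ε_k`: equal to `0` if `k` is even and to `1` if `k` is odd. -/
def parity (k : ℕ) : ℕ := if Even k then 0 else 1

/-- `⟨k⟩`: the residue of `k` modulo `p - 1` in `{0, …, p - 2}`. -/
def residue (p k : ℕ) : ℕ := k % (p - 1)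

/-- A prime `p` is regular if `v_p(B_l) = 0` for all even `l` with `2 ≤ l ≤ p - 3`. Here `bernoulli`
is the sequence with exponential generating function `x / (e ^ x - 1)`. -/
def IsRegularPrime (p : ℕ) : Prop :=
  p.Prime ∧ ∀ l : ℕ, Even l → 2 ≤ l → l + 3 ≤ p → padicValRat p (bernoulli l) = 0

end StirlingValuation

namespace StirlingValuation

/-! The numbers `s(ap, m)` are the coefficients of the rising factorial of length `ap`, a product of
`a` translates of the one of length `p`. Put `T = X ^ p - X` and write the latter as `T + pG`.
Modulo `p` the product is `T ^ a`. Its codegree-`k` coefficient is 0 unless `p - 1 ∣ k`, and is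
otherwise a signed binomial coefficient prime to `p`. This settles (i) for even `k`. Modulo `p ^ 2`,
for even `k` with `p - 1 ∤ k`, only `p a T ^ (a - 1) G` contributes, which reduces the question to
`a = 1` and `k % (p - 1)` (`sq_dvd_stirlingFirst_iff`). Newton's identities turn that case into a
power sum, and Faulhaber's formula turns the power sum into a Bernoulli number. Odd `k` reduces to
`k - 1`: the symmetry `X ↦ -X - N` of `(X + 1) ⋯ (X + N - 1)`, `N = ap`, gives `2 s(N, N-k) = (N-k)
N s(N, N-k+1) - ⋯`, whose leading factor accounts for `v_p(k) + 1`
(`pow_dvd_stirlingFirst_odd_iff`). Part (iii) comes from substituting `pX` for `X`. -/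

open Polynomial hiding bernoulli sum_bernoulli

/-! ### Stirling numbers as coefficients, and the bound for (iii) -/

/-- The coefficients of the rising factorial are the Stirling numbers of the first kind. -/
theorem coeff_ascPochhammer (R : Type*) [CommRing R] (n k : ℕ) :
    (ascPochhammer R n).coeff k = (Nat.stirlingFirst n k : R) := by
  induction n generalizing k with
  | zero =>
    cases k with
    | zero => simp
    | succ k => simp [coeff_one]
  | succ n ih =>
    rw [ascPochhammer_succ_right, mul_add, coeff_add, ← C_eq_natCast, coeff_mul_C]
    cases k with
    | zero =>
      rw [coeff_mul_X_zero, ih, Nat.stirlingFirst_succ_zero]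
      cases n with
      | zero => simp
      | succ n => simp
    | succ k =>
      rw [coeff_mul_X, ih, ih, Nat.stirlingFirst_succ_succ]
      push_cast
      ring

theorem stirlingFirst_pos {n k : ℕ} (hk : 1 ≤ k) (hkn : k ≤ n) : 0 < Nat.stirlingFirst n k := by
  induction n generalizing k with
  | zero => omega
  | succ n ih =>
    obtain ⟨k, rfl⟩ := Nat.exists_eq_add_of_le' hk
    rw [Nat.stirlingFirst_succ_succ]
    rcases Nat.lt_or_ge k n with h | h
    · have := ih (k := k + 1) (by omega) (by omega)
      have : 0 < n * Nat.stirlingFirst n (k + 1) := Nat.mul_pos (by omega) this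
      omega
    · have : k = n := by omega
      subst this
      simp [Nat.stirlingFirst_self]

theorem ascPochhammer_eq_prod (R : Type*) [CommRing R] (n : ℕ) :
    ascPochhammer R n = ∏ i ∈ Finset.range n, (X + C (i : R)) := by
  induction n with
  | zero => simp
  | succ n ih => rw [ascPochhammer_succ_right, Finset.prod_range_succ, ih]; simp

/-- `m ↦ p m` turns the `a` factors of the rising factorial of length `a p` that are indexed by
multiples of `p` into multiples of `p`. -/
theorem pow_dvd_ascPochhammer_comp (p a : ℕ) (hp : 1 ≤ p) :
    (C (p : ℤ)) ^ a ∣ (ascPochhammer ℤ (a * p)).comp (C (p : ℤ) * X) := by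
  induction a with
  | zero => simp
  | succ a ih =>
    rw [add_mul, one_mul, ← ascPochhammer_mul, mul_comp, pow_succ]
    refine mul_dvd_mul ih ?_
    obtain ⟨q, rfl⟩ := Nat.exists_eq_add_of_le' hp
    rw [ascPochhammer_succ_left, mul_comp, mul_comp]
    refine Dvd.dvd.mul_right ?_ _
    refine ⟨X + C (a : ℤ), ?_⟩
    simp
    ring

/-- Substituting `pX` multiplies the coefficient of `X ^ m` by `p ^ m`, so `p ^ a` divides `p ^ m
s(ap, m)`. -/
theorem pow_sub_dvd_stirlingFirst {p : ℕ} (hp : 1 ≤ p) {a m : ℕ} (hm : m ≤ a) :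
    p ^ (a - m) ∣ Nat.stirlingFirst (a * p) m := by
  obtain ⟨H, hH⟩ := pow_dvd_ascPochhammer_comp p a hp
  have h := congrArg (fun f => coeff f m) hH
  simp only [comp_C_mul_X_coeff, ← C_pow, coeff_C_mul, coeff_ascPochhammer] at h
  obtain ⟨d, rfl⟩ := Nat.exists_eq_add_of_le hm
  rw [Nat.add_sub_cancel_left]
  have hp0 : (p : ℤ) ^ m ≠ 0 := pow_ne_zero _ (by exact_mod_cast (by omega : p ≠ 0))
  have : ((p ^ d : ℕ) : ℤ) ∣ (Nat.stirlingFirst ((m + d) * p) m : ℤ) := by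
    refine ⟨H.coeff m, mul_right_cancel₀ hp0 ?_⟩
    rw [h]; push_cast; ring
  exact_mod_cast this

/-! ### The rising factorial modulo `p` and `p ^ 2` -/

/-- Both sides are monic of degree `p` and vanish on all of `ZMod p`. -/
theorem ascPochhammer_zmod (p : ℕ) [Fact p.Prime] :
    ascPochhammer (ZMod p) p = X ^ p - X := by
  have hp := (Fact.out : p.Prime)
  have hdeg : (ascPochhammer (ZMod p) p).degree = p := by
    rw [degree_eq_natDegree (monic_ascPochhammer _ p).ne_zero, ascPochhammer_natDegree]
  have hX : (X : (ZMod p)[X]).degree < ((X : (ZMod p)[X]) ^ p).degree := by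
    rw [degree_X_pow, degree_X]; exact_mod_cast hp.one_lt
  have hdeg' : (X ^ p - X : (ZMod p)[X]).degree = p := by
    rw [degree_sub_eq_left_of_degree_lt hX, degree_X_pow]
  have hmon : (X ^ p - X : (ZMod p)[X]).leadingCoeff = 1 := by
    rw [leadingCoeff_sub_of_degree_lt hX]; simp
  refine eq_of_degree_sub_lt_of_eval_finset_eq (Finset.univ : Finset (ZMod p)) ?_ ?_
  · rw [Finset.card_univ, ZMod.card, ← hdeg]
    exact degree_sub_lt_left (hdeg.trans hdeg'.symm) (monic_ascPochhammer _ p).ne_zero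
      ((monic_ascPochhammer _ p).leadingCoeff.trans hmon.symm)
  · intro x _
    rw [eval_sub, eval_pow, eval_X, ZMod.pow_card, sub_self, ascPochhammer_eq_prod, eval_prod]
    refine Finset.prod_eq_zero (i := (-x).val) (Finset.mem_range.2 (ZMod.val_lt _)) ?_
    simp

/-- The rising factorial of length `p` is `X ^ p - X` modulo `p`. -/
theorem exists_ascPochhammer_eq (p : ℕ) [Fact p.Prime] :
    ∃ G : ℤ[X], ascPochhammer ℤ p = (X ^ p - X) + C (p : ℤ) * G := by
  have : C (p : ℤ) ∣ ascPochhammer ℤ p - (X ^ p - X) := by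
    rw [C_dvd_iff_dvd_coeff]
    intro i
    rw [← ZMod.intCast_zmod_eq_zero_iff_dvd _ p]
    have := congrArg (fun f => coeff f i) (ascPochhammer_zmod p)
    rw [← sub_eq_zero, ← coeff_sub] at this
    rw [← this, ← eq_intCast (Int.castRingHom (ZMod p)), ← coeff_map]
    simp [Polynomial.map_sub]
  obtain ⟨G, hG⟩ := this
  exact ⟨G, by rw [← hG]; ring⟩

theorem dvd_comp_X_add_C_sub (f : ℤ[X]) (c : ℤ) : C c ∣ f.comp (X + C c) - f := by
  have := sub_dvd_eval_sub (X + C c) X (f.map C)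
  rwa [eval_map, eval_map, ← comp, ← comp, comp_X, add_sub_cancel_left] at this

/-- A polynomial that is `X ^ p - X` modulo `p` changes by `-c` under translation by a multiple
`c` of `p`, modulo `p ^ 2`. -/
theorem sq_dvd_comp_X_add_C_sub (p j : ℕ) (G : ℤ[X]) :
    C (p : ℤ) ^ 2 ∣ ((X ^ p - X) + C (p : ℤ) * G).comp (X + C ((j * p : ℕ) : ℤ)) -
      (X ^ p - X + C (p : ℤ) * (G - C (j : ℤ))) := by
  -- Bases congruent modulo `p` have `p`-th powers congruent modulo `p ^ 2`, so within `X ^ p - X`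
  -- only the linear term moves.
  have h1 : C (p : ℤ) ^ 2 ∣ (X + C ((j * p : ℕ) : ℤ)) ^ p - X ^ p := by
    have := dvd_sub_pow_of_dvd_sub (R := ℤ[X]) (p := p) (a := X + C ((j * p : ℕ) : ℤ)) (b := X)
      ⟨C (j : ℤ), by simp; ring⟩ 1
    simpa using this
  have h2 : C (p : ℤ) ∣ G.comp (X + C ((j * p : ℕ) : ℤ)) - G :=
    dvd_trans ⟨C (j : ℤ), by push_cast; simp; ring⟩ (dvd_comp_X_add_C_sub G _)
  obtain ⟨u, hu⟩ := h1
  obtain ⟨v, hv⟩ := h2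
  refine ⟨u + v, ?_⟩
  simp only [add_comp, sub_comp, mul_comp, pow_comp, X_comp, C_comp]
  rw [sub_eq_iff_eq_add] at hu hv
  rw [hu, hv]
  push_cast
  simp
  ring

/-- The rising factorial of length `(b + 1) p` modulo `p ^ 2`. -/
theorem exists_ascPochhammer_mul_eq {p : ℕ} {G : ℤ[X]}
    (hG : ascPochhammer ℤ p = (X ^ p - X) + C (p : ℤ) * G) (b : ℕ) :
    ∃ H : ℤ[X], ascPochhammer ℤ ((b + 1) * p) = (X ^ p - X) ^ (b + 1) +
      C (p : ℤ) * (C ((b : ℤ) + 1) * ((X ^ p - X) ^ b * G) -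
        C (((b + 1).choose 2 : ℕ) : ℤ) * (X ^ p - X) ^ b) + C (p : ℤ) ^ 2 * H := by
  induction b with
  | zero => exact ⟨0, by simp [hG]⟩
  | succ b ih =>
    obtain ⟨H, hH⟩ := ih
    obtain ⟨K, hK⟩ := sq_dvd_comp_X_add_C_sub p (b + 1) G
    rw [sub_eq_iff_eq_add] at hK
    have h : ascPochhammer ℤ ((b + 1 + 1) * p) = ascPochhammer ℤ ((b + 1) * p) *
        ((X ^ p - X) + C (p : ℤ) * G).comp (X + C (((b + 1) * p : ℕ) : ℤ)) := by
      rw [add_mul (b + 1), one_mul, ← ascPochhammer_mul, hG]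
      simp
    -- The block translated by `jp` contributes the correction `-j`; these add up to a triangular
    -- number.
    have hc : ((b + 1 + 1).choose 2 : ℕ) = (b + 1) + (b + 1).choose 2 := by
      rw [Nat.choose_succ_succ' (b + 1) 1, Nat.choose_one_right]
    rw [h, hH, hK, hc]
    generalize (X ^ p - X : ℤ[X]) = T
    generalize (b + 1).choose 2 = c
    refine ⟨H * (T + C (p : ℤ) * (G - C ((b + 1 : ℕ) : ℤ))) +
      (C ((b : ℤ) + 1) * (T ^ b * G) - C (c : ℤ) * T ^ b) * (G - C ((b + 1 : ℕ) : ℤ)) +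
      K * (T ^ (b + 1) + C (p : ℤ) * (C ((b : ℤ) + 1) * (T ^ b * G) - C (c : ℤ) * T ^ b) +
        C (p : ℤ) ^ 2 * H), ?_⟩
    push_cast
    simp only [map_add, map_one]
    ring

/-! ### Coefficients of powers of `X ^ p - X` -/

theorem X_pow_sub_X_pow_eq_sum (p b : ℕ) :
    (X ^ p - X : ℤ[X]) ^ b =
      ∑ j ∈ Finset.range (b + 1), C ((-1) ^ j * (b.choose j : ℤ)) * X ^ (j + p * (b - j)) := by
  rw [show (X ^ p - X : ℤ[X]) = -X + X ^ p by ring, add_pow]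
  refine Finset.sum_congr rfl fun j _ => ?_
  rw [neg_pow, pow_add, pow_mul]
  simp
  ring

theorem coeff_X_pow_sub_X_pow (p b n : ℕ) :
    ((X ^ p - X : ℤ[X]) ^ b).coeff n =
      ∑ j ∈ Finset.range (b + 1),
        if n = j + p * (b - j) then (-1) ^ j * (b.choose j : ℤ) else 0 := by
  rw [X_pow_sub_X_pow_eq_sum, finsetSum_coeff]
  refine Finset.sum_congr rfl fun j _ => ?_
  rw [coeff_C_mul, coeff_X_pow, mul_ite, mul_one, mul_zero]

theorem coeff_X_pow_sub_X_pow_mul (p b n : ℕ) (G : ℤ[X]) :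
    ((X ^ p - X : ℤ[X]) ^ b * G).coeff n =
      ∑ j ∈ Finset.range (b + 1),
        if j + p * (b - j) ≤ n then
          (-1) ^ j * (b.choose j : ℤ) * G.coeff (n - (j + p * (b - j))) else 0 := by
  rw [X_pow_sub_X_pow_eq_sum, Finset.sum_mul, finsetSum_coeff]
  refine Finset.sum_congr rfl fun j _ => ?_
  rw [mul_assoc, coeff_C_mul, coeff_X_pow_mul', mul_ite, mul_zero]

/-- The `j`-th binomial term lies in codegree `j (p - 1)`, measured from the top degree `bp`. -/
theorem coeff_X_pow_sub_X_pow_eq_zero {p b k n : ℕ} (hp : 1 ≤ p) (hn : n + k = b * p)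
    (hk : ¬ (p - 1) ∣ k) : ((X ^ p - X : ℤ[X]) ^ b).coeff n = 0 := by
  rw [coeff_X_pow_sub_X_pow]
  refine Finset.sum_eq_zero fun j hj => if_neg fun h => hk ⟨j, ?_⟩
  obtain ⟨i, rfl⟩ := Nat.exists_eq_add_of_le (Nat.lt_succ_iff.1 (Finset.mem_range.1 hj))
  obtain ⟨q, rfl⟩ := Nat.exists_eq_add_of_le' hp
  rw [Nat.add_sub_cancel_left] at h
  rw [Nat.add_sub_cancel]
  subst h
  linarith

theorem coeff_X_pow_sub_X_pow_of_eq {p b j n : ℕ} (hp : 2 ≤ p) (hj : j ≤ b)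
    (hn : n + j * (p - 1) = b * p) :
    ((X ^ p - X : ℤ[X]) ^ b).coeff n = (-1) ^ j * (b.choose j : ℤ) := by
  obtain ⟨q, rfl⟩ := Nat.exists_eq_add_of_le' hp
  rw [show q + 2 - 1 = q + 1 by omega] at hn
  rw [coeff_X_pow_sub_X_pow, Finset.sum_eq_single j]
  · rw [if_pos]
    obtain ⟨i, rfl⟩ := Nat.exists_eq_add_of_le hj
    rw [Nat.add_sub_cancel_left]
    linarith
  · intro i hi hij
    refine if_neg fun h => hij ?_
    obtain ⟨l, rfl⟩ := Nat.exists_eq_add_of_le (Nat.lt_succ_iff.1 (Finset.mem_range.1 hi))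
    rw [Nat.add_sub_cancel_left] at h
    have : i * (q + 1) = j * (q + 1) := by subst h; linarith
    exact Nat.eq_of_mul_eq_mul_right (Nat.succ_pos q) this
  · intro h
    exact absurd (Finset.mem_range.2 (by omega)) h

/-- Only one term of `(X ^ p - X) ^ b` contributes to a coefficient of its product with a
polynomial supported in degrees `1, …, p - 1`. -/
theorem coeff_X_pow_sub_X_pow_mul_of_eq {p b q r n : ℕ} {G : ℤ[X]} (hp : 2 ≤ p) (hq : q ≤ b)
    (hr1 : 1 ≤ r) (hr : r ≤ p - 1) (hn : n + (q * (p - 1) + r) = (b + 1) * p)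
    (hG0 : G.coeff 0 = 0) (hG : ∀ i, p ≤ i → G.coeff i = 0) :
    ((X ^ p - X : ℤ[X]) ^ b * G).coeff n = (-1) ^ q * (b.choose q : ℤ) * G.coeff (p - r) := by
  obtain ⟨c, rfl⟩ := Nat.exists_eq_add_of_le' hp
  rw [show c + 2 - 1 = c + 1 by omega] at hn hr
  rw [coeff_X_pow_sub_X_pow_mul, Finset.sum_eq_single q]
  · obtain ⟨i, rfl⟩ := Nat.exists_eq_add_of_le hq
    rw [Nat.add_sub_cancel_left]
    have : n = (q + (c + 2) * i) + (c + 2 - r) := by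
      zify [show r ≤ c + 2 by omega] at hn ⊢
      linarith
    rw [if_pos (by omega), show n - (q + (c + 2) * i) = c + 2 - r by omega]
  · intro j hj hjq
    obtain ⟨i, hi⟩ := Nat.exists_eq_add_of_le (Nat.lt_succ_iff.1 (Finset.mem_range.1 hj))
    split_ifs with h
    · obtain ⟨d, hd⟩ := Nat.exists_eq_add_of_le h
      rw [hd, Nat.add_sub_cancel_left]
      have hbj : b - j = i := by omega
      rw [hbj] at hd
      have key : d + q * (c + 1) + r = j * (c + 1) + (c + 2) := by
        rw [hd, hi] at hn
        linarith
      -- Here `p = c + 2`. If `j < q` then `d + r ≤ 1`, so `d = 0`; if `j > q` then `d ≥ p` because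
      -- `r ≤ p - 1`.
      rcases Nat.lt_or_ge j q with hlt | hge
      · have : (j + 1) * (c + 1) ≤ q * (c + 1) := Nat.mul_le_mul_right _ hlt
        have hd0 : d = 0 := by
          rw [add_mul] at this
          omega
        rw [hd0, hG0, mul_zero]
      · have : (q + 1) * (c + 1) ≤ j * (c + 1) := Nat.mul_le_mul_right _ (by omega)
        rw [hG d (by rw [add_mul] at this; omega), mul_zero]
    · rfl
  · intro h
    exact absurd (Finset.mem_range.2 (by omega)) h

section

variable {p : ℕ} {G : ℤ[X]}

theorem mul_coeff_eq (hG : ascPochhammer ℤ p = (X ^ p - X) + C (p : ℤ) * G) (i : ℕ) :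
    (p : ℤ) * G.coeff i =
      Nat.stirlingFirst p i - ((if i = p then 1 else 0) - (if i = 1 then 1 else 0)) := by
  have h := congrArg (fun f => coeff f i) hG
  simp only [coeff_add, coeff_sub, coeff_C_mul, coeff_X_pow, coeff_X, coeff_ascPochhammer] at h
  simp only [eq_comm (a := i) (b := 1)]
  linarith

theorem coeff_zero_eq_zero (hp : 2 ≤ p)
    (hG : ascPochhammer ℤ p = (X ^ p - X) + C (p : ℤ) * G) : G.coeff 0 = 0 := by
  have h := mul_coeff_eq hG 0
  obtain ⟨q, rfl⟩ := Nat.exists_eq_add_of_le' (by omega : 1 ≤ p)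
  simp only [Nat.stirlingFirst_succ_zero] at h
  simp at h
  rcases h with h | h
  · omega
  · exact h

theorem coeff_eq_zero_of_le (hp : 2 ≤ p)
    (hG : ascPochhammer ℤ p = (X ^ p - X) + C (p : ℤ) * G) (i : ℕ) (hi : p ≤ i) :
    G.coeff i = 0 := by
  have h := mul_coeff_eq hG i
  have hp0 : (p : ℤ) ≠ 0 := by exact_mod_cast (by omega : p ≠ 0)
  refine mul_left_cancel₀ hp0 ?_
  rw [h, mul_zero, if_neg (by omega : i ≠ 1)]
  rcases hi.eq_or_lt with rfl | hlt
  · simp [Nat.stirlingFirst_self]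
  · rw [if_neg (by omega), Nat.stirlingFirst_eq_zero_of_lt hlt]
    simp

end

/-! ### Divisibility of Stirling numbers by `p` and `p ^ 2` -/

theorem not_dvd_choose_of_lt {p b q : ℕ} (hp : p.Prime) (hb : b < p) (hq : q ≤ b) :
    ¬ p ∣ b.choose q := fun h =>
  absurd ((hp.dvd_factorial).1 (h.trans ⟨_, by
    rw [← Nat.choose_mul_factorial_mul_factorial hq, mul_assoc]⟩)) (by omega)

theorem dvd_stirlingFirst_iff {p a n : ℕ} (hp : p.Prime) :
    p ∣ Nat.stirlingFirst (a * p) n ↔ (p : ℤ) ∣ ((X ^ p - X : ℤ[X]) ^ a).coeff n := by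
  have := Fact.mk hp
  obtain ⟨G, hG⟩ := exists_ascPochhammer_eq p
  cases a with
  | zero =>
    rw [← Int.natCast_dvd_natCast, ← coeff_ascPochhammer ℤ]
    simp
  | succ b =>
    obtain ⟨H, hH⟩ := exists_ascPochhammer_mul_eq hG b
    have h := congrArg (fun f => coeff f n) hH
    simp only [coeff_add, coeff_C_mul, ← C_pow, coeff_ascPochhammer] at h
    rw [← Int.natCast_dvd_natCast]
    rw [h, sq, mul_assoc, add_assoc, ← mul_add]
    exact (dvd_add_left (dvd_mul_right _ _))

theorem not_dvd_stirlingFirst {p a k : ℕ} (hp : p.Prime) (hap : a < p) (hk : (p - 1) ∣ k)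
    (hka : k ≤ a * (p - 1)) : ¬ p ∣ Nat.stirlingFirst (a * p) (a * p - k) := by
  obtain ⟨j, rfl⟩ := hk
  have hp2 := hp.two_le
  have hj : j ≤ a := by
    rw [mul_comm] at hka
    exact Nat.le_of_mul_le_mul_right hka (by omega)
  have hle : (p - 1) * j ≤ a * p := by
    rw [mul_comm (p - 1)]
    exact Nat.mul_le_mul hj (by omega)
  rw [dvd_stirlingFirst_iff hp, coeff_X_pow_sub_X_pow_of_eq hp2 hj
    (by rw [mul_comm j]; omega), (isUnit_one.neg.pow j).dvd_mul_left, Int.natCast_dvd_natCast]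
  exact not_dvd_choose_of_lt hp hap hj

theorem dvd_stirlingFirst {p a k : ℕ} (hp : p.Prime) (hk : ¬ (p - 1) ∣ k) (hka : k ≤ a * p) :
    p ∣ Nat.stirlingFirst (a * p) (a * p - k) := by
  rw [dvd_stirlingFirst_iff hp,
    coeff_X_pow_sub_X_pow_eq_zero hp.one_le (Nat.sub_add_cancel hka) hk]
  exact dvd_zero _

/-- In the expansion modulo `p ^ 2`, the `T ^ a` term drops out since `p - 1 ∤ k` and the `T ^ (a -
1)` term by parity. What is left is `p` times a `p`-adic unit times one coefficient of `G`, and `p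
G` has the coefficient `s(p, p - r)` there. -/
theorem sq_dvd_stirlingFirst_iff {p a k : ℕ} (hp : p.Prime) (hp3 : 3 ≤ p) (ha : 1 ≤ a)
    (hap : a < p) (hke : Even k) (hk : ¬ (p - 1) ∣ k) (hka : k < a * (p - 1)) :
    p ^ 2 ∣ Nat.stirlingFirst (a * p) (a * p - k) ↔
      p ^ 2 ∣ Nat.stirlingFirst p (p - k % (p - 1)) := by
  have := Fact.mk hp
  have hodd : Odd p := hp.odd_of_ne_two (by omega)
  obtain ⟨G, hG⟩ := exists_ascPochhammer_eq p
  obtain ⟨b, rfl⟩ := Nat.exists_eq_add_of_le' ha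
  obtain ⟨H, hH⟩ := exists_ascPochhammer_mul_eq hG b
  have hle : k ≤ (b + 1) * p := hka.le.trans (Nat.mul_le_mul_left _ (by omega))
  set r := k % (p - 1) with hr
  have hrlt : r < p - 1 := Nat.mod_lt _ (by omega)
  have hr0 : r ≠ 0 := fun h => hk (Nat.dvd_of_mod_eq_zero h)
  have hre : Even r := (Nat.even_sub (by omega : 1 ≤ p) |>.2 (by simp [hodd])).elim
    fun u hu => by
      rw [hr, Nat.even_iff, Nat.mod_mod_of_dvd _ ⟨u, by omega⟩, ← Nat.even_iff]; exact hke
  set q := k / (p - 1) with hq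
  have hqr : q * (p - 1) + r = k := Nat.div_add_mod' k (p - 1)
  have hqb : q ≤ b := Nat.lt_succ_iff.1 (Nat.div_lt_of_lt_mul (by rw [mul_comm]; exact hka))
  have h := congrArg (fun f => coeff f ((b + 1) * p - k)) hH
  simp only [coeff_add, coeff_sub, coeff_C_mul, ← C_pow, coeff_ascPochhammer] at h
  -- As `p` is odd, all exponents in `T ^ b` have the parity of `b`, while `(b + 1) p - k` has the
  -- opposite one.
  have hTb : ((X ^ p - X : ℤ[X]) ^ b).coeff ((b + 1) * p - k) = 0 := by
    rw [coeff_X_pow_sub_X_pow]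
    refine Finset.sum_eq_zero fun j hj => if_neg fun h => ?_
    obtain ⟨i, hi⟩ := Nat.exists_eq_add_of_le (Nat.lt_succ_iff.1 (Finset.mem_range.1 hj))
    obtain ⟨u, hu⟩ := hodd
    have e1 : b - j = i := by omega
    rw [e1] at h
    have e2 : k + (j + p * i) = (b + 1) * p := by omega
    rw [hi, hu] at e2
    have e3 : k = 2 * (j * u + u) + 1 := by linarith
    rw [e3] at hke
    exact absurd hke (by simp)
  rw [coeff_X_pow_sub_X_pow_eq_zero hp.one_le (Nat.sub_add_cancel hle) hk, hTb,
    coeff_X_pow_sub_X_pow_mul_of_eq (r := r) hp.two_le hqb (by omega) (by omega)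
      (by rw [hqr]; exact Nat.sub_add_cancel hle) (coeff_zero_eq_zero hp.two_le hG)
      (coeff_eq_zero_of_le hp.two_le hG)] at h
  have hr2 : 2 ≤ r := by obtain ⟨u, hu⟩ := hre; omega
  have hs := mul_coeff_eq hG (p - r)
  rw [if_neg (by omega), if_neg (by omega)] at hs
  have hp0 : (p : ℤ) ≠ 0 := by exact_mod_cast (by omega : p ≠ 0)
  have hpZ : Prime (p : ℤ) := Nat.prime_iff_prime_int.1 hp
  have hb1 : ¬ (p : ℤ) ∣ (b : ℤ) + 1 := fun hd =>
    absurd (Nat.le_of_dvd (by omega) (by exact_mod_cast hd : p ∣ b + 1)) (by omega)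
  have hbq : ¬ (p : ℤ) ∣ (b.choose q : ℤ) := fun hd =>
    not_dvd_choose_of_lt hp (by omega) hqb (by exact_mod_cast hd)
  have e1 : ((p ^ 2 : ℕ) : ℤ) ∣ (Nat.stirlingFirst ((b + 1) * p) ((b + 1) * p - k) : ℤ) ↔
      (p : ℤ) ∣ G.coeff (p - r) := by
    rw [h, Nat.cast_pow, zero_add, mul_zero, sub_zero, dvd_add_left (dvd_mul_right _ _), sq,
      mul_dvd_mul_iff_left hp0, hpZ.dvd_mul, mul_assoc,
      (isUnit_one.neg.pow q).dvd_mul_left, hpZ.dvd_mul]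
    tauto
  have e2 : ((p ^ 2 : ℕ) : ℤ) ∣ (Nat.stirlingFirst p (p - r) : ℤ) ↔
      (p : ℤ) ∣ G.coeff (p - r) := by
    rw [show (Nat.stirlingFirst p (p - r) : ℤ) = p * G.coeff (p - r) by rw [hs]; ring,
      Nat.cast_pow, sq, mul_dvd_mul_iff_left hp0]
  rw [← Int.natCast_dvd_natCast, e1, ← e2, Int.natCast_dvd_natCast]

/-! ### Newton's identities and power sums -/

theorem aeval_esymm_eq_stirlingFirst {n m : ℕ} (hm : m ≤ n) :
    MvPolynomial.aeval (fun i : Fin n => ((i : ℕ) : ℤ)) (MvPolynomial.esymm (Fin n) ℤ m) =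
      Nat.stirlingFirst n (n - m) := by
  have h := Finset.prod_X_add_C_coeff (Finset.univ : Finset (Fin n))
    (fun i : Fin n => ((i : ℕ) : ℤ)) (k := n - m) (by simp)
  rw [Fin.prod_univ_eq_prod_range (fun i : ℕ => (X + C (i : ℤ) : ℤ[X])) n,
    ← ascPochhammer_eq_prod, coeff_ascPochhammer, Finset.card_univ, Fintype.card_fin,
    Nat.sub_sub_self hm] at h
  rw [h, MvPolynomial.esymm, map_sum]
  refine Finset.sum_congr rfl fun t _ => ?_
  rw [map_prod]
  simp

theorem aeval_psum_eq_sum_pow (n m : ℕ) :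
    MvPolynomial.aeval (fun i : Fin n => ((i : ℕ) : ℤ)) (MvPolynomial.psum (Fin n) ℤ m) =
      ∑ i ∈ Finset.range n, (i : ℤ) ^ m := by
  rw [MvPolynomial.psum, map_sum, ← Fin.sum_univ_eq_sum_range (fun i : ℕ => (i : ℤ) ^ m)]
  simp

theorem dvd_sum_pow {p m : ℕ} (hp : p.Prime) (hm : m < p - 1) :
    (p : ℤ) ∣ ∑ i ∈ Finset.range p, (i : ℤ) ^ m := by
  have := Fact.mk hp
  rw [← ZMod.intCast_zmod_eq_zero_iff_dvd _ p, ← FiniteField.sum_pow_lt_card_sub_one (ZMod p) m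
    (by rwa [ZMod.card])]
  push_cast
  refine Finset.sum_bij' (fun i _ => (i : ZMod p)) (fun x _ => x.val) (by simp)
    (fun x _ => Finset.mem_range.2 x.val_lt)
    (fun i hi => ZMod.val_cast_of_lt (Finset.mem_range.1 hi)) (by simp) (by simp)

/-- Newton's identity for `0, …, p - 1`, modulo `p ^ 2`. -/
theorem sq_dvd_stirlingFirst_iff_sq_dvd_sum_pow {p m : ℕ} (hp : p.Prime) (hm1 : 1 ≤ m)
    (hm : m < p - 1) :
    p ^ 2 ∣ Nat.stirlingFirst p (p - m) ↔
      (p : ℤ) ^ 2 ∣ ∑ i ∈ Finset.range p, (i : ℤ) ^ m := by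
  have h := congrArg (MvPolynomial.aeval (fun i : Fin p => ((i : ℕ) : ℤ)))
    (MvPolynomial.psum_eq_mul_esymm_sub_sum (Fin p) ℤ m hm1)
  rw [map_sub, map_sum, aeval_psum_eq_sum_pow] at h
  -- Each mixed term is a product of an elementary symmetric value and a power sum, both divisible
  -- by `p`.
  have hdvd : (p : ℤ) ^ 2 ∣ ∑ a ∈ Finset.HasAntidiagonal.antidiagonal m with a.1 ∈ Set.Ioo 0 m,
      MvPolynomial.aeval (fun i : Fin p => ((i : ℕ) : ℤ))
        ((-1) ^ a.1 * MvPolynomial.esymm (Fin p) ℤ a.1 * MvPolynomial.psum (Fin p) ℤ a.2) := by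
    refine Finset.dvd_sum fun a ha => ?_
    simp only [Finset.mem_filter, Finset.HasAntidiagonal.mem_antidiagonal, Set.mem_Ioo] at ha
    rw [map_mul, map_mul, aeval_psum_eq_sum_pow, aeval_esymm_eq_stirlingFirst (by omega), sq]
    refine mul_dvd_mul (Dvd.dvd.mul_left ?_ _) (dvd_sum_pow hp (by omega))
    have := dvd_stirlingFirst (a := 1) (k := a.1) hp
      (fun hd => absurd (Nat.le_of_dvd (by omega) hd) (by omega)) (by omega)
    rw [one_mul] at this
    exact_mod_cast this
  rw [map_mul, aeval_esymm_eq_stirlingFirst (by omega)] at h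
  rw [h, dvd_sub_left hdvd]
  have hmp : IsCoprime ((p : ℤ) ^ 2) (m : ℤ) := by
    refine IsCoprime.pow_left (Nat.isCoprime_iff_coprime.2 ?_)
    exact (hp.coprime_iff_not_dvd).2
      fun hd => absurd (Nat.le_of_dvd (by omega) hd) (by omega)
  have he : MvPolynomial.aeval (fun i : Fin p => ((i : ℕ) : ℤ))
      ((-1) ^ (m + 1) * (m : MvPolynomial (Fin p) ℤ)) = (-1) ^ (m + 1) * (m : ℤ) := by simp
  rw [he, mul_assoc, (isUnit_one.neg.pow (m + 1)).dvd_mul_left, ← Int.natCast_dvd_natCast,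
    Nat.cast_pow]
  exact ⟨fun hd => hd.mul_left _, hmp.dvd_of_dvd_mul_left⟩

/-! ### Bernoulli numbers and their `p`-integrality -/

/-- Otherwise `ζ(2k)` would be zero, although its series has nonnegative terms and a positive one.
Nonvanishing matters since `padicValRat p 0 = 0` would pass for a unit. -/
theorem bernoulli_two_mul_ne_zero {k : ℕ} (hk : k ≠ 0) : bernoulli (2 * k) ≠ 0 := by
  intro h
  have hs := hasSum_zeta_nat hk
  rw [h] at hs
  simp only [Rat.cast_zero, mul_zero, zero_div] at hs
  have := (hasSum_zero_iff_of_nonneg (fun n => by positivity)).1 hs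
  have := congrFun this 1
  simp at this

section

variable {p : ℕ} [Fact p.Prime]

theorem natCast_inv_mem_integer {n : ℕ} (h0 : n ≠ 0) (h : ¬ p ∣ n) :
    ((n : ℚ))⁻¹ ∈ (Rat.padicValuation p).integer := by
  rw [Valuation.mem_integer_iff, Rat.padicValuation_le_one_iff]
  simpa [h0] using h

/-- Bernoulli numbers of index at most `p - 2` are `p`-integral. -/
theorem bernoulli_mem_integer {n : ℕ} (hn : n + 2 ≤ p) :
    bernoulli n ∈ (Rat.padicValuation p).integer := by
  induction n using Nat.strong_induction_on with
  | _ n ih =>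
    have h := sum_bernoulli (n + 1)
    rw [Finset.sum_range_succ, Nat.choose_succ_self_right] at h
    have hn0 : ((n + 1 : ℕ) : ℚ) ≠ 0 := by positivity
    have : bernoulli n = ((n + 1 : ℕ) : ℚ)⁻¹ * ((if n + 1 = 1 then 1 else 0) -
        ∑ k ∈ Finset.range n, ((n + 1).choose k : ℚ) * bernoulli k) := by
      rw [← h]
      field_simp
      ring
    rw [this]
    refine mul_mem (natCast_inv_mem_integer (by omega)
      (fun hd => absurd (Nat.le_of_dvd (by omega) hd) (by omega))) (sub_mem ?_ (sum_mem ?_))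
    · split_ifs
      exacts [one_mem _, zero_mem _]
    · intro k hk
      have := Finset.mem_range.1 hk
      exact mul_mem (natCast_mem _ _) (ih k this (by omega))

theorem mem_integer_iff {x : ℚ} (hx : x ≠ 0) :
    x ∈ (Rat.padicValuation p).integer ↔ 0 ≤ padicValRat p x := by
  rw [Valuation.mem_integer_iff]
  change (if x = 0 then _ else _) ≤ _ ↔ _
  rw [if_neg hx, ← WithZero.exp_zero, WithZero.exp_le_exp]
  omega

theorem div_mem_integer_iff {x : ℚ} (hx0 : x ≠ 0) (hx : x ∈ (Rat.padicValuation p).integer) :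
    x / p ∈ (Rat.padicValuation p).integer ↔ padicValRat p x ≠ 0 := by
  have hp : (p : ℚ) ≠ 0 := by exact_mod_cast (Fact.out : p.Prime).ne_zero
  rw [mem_integer_iff hx0] at hx
  rw [mem_integer_iff (div_ne_zero hx0 hp), padicValRat.div hx0 hp, padicValRat.self
    (Fact.out : p.Prime).one_lt]
  omega

theorem intCast_div_mem_integer_iff (x : ℤ) (m : ℕ) :
    (x : ℚ) / p ^ m ∈ (Rat.padicValuation p).integer ↔ (p : ℤ) ^ m ∣ x := by
  have hp : (p : ℚ) ^ m ≠ 0 := pow_ne_zero _ (by exact_mod_cast (Fact.out : p.Prime).ne_zero)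
  rcases eq_or_ne x 0 with rfl | hx
  · simp
  have hx' : (x : ℚ) ≠ 0 := by exact_mod_cast hx
  rw [mem_integer_iff (div_ne_zero hx' hp), padicValRat.div hx' hp,
    padicValRat.pow, padicValRat.self
    (Fact.out : p.Prime).one_lt, padicValRat.of_int, padicValInt_dvd_iff]
  omega

/-- The power sums over `0, …, p - 1` are `p` times Bernoulli numbers, modulo `p ^ 2`. -/
theorem sq_dvd_sum_pow_iff {m : ℕ} (hm0 : m ≠ 0) (hme : Even m) (hm : m + 3 ≤ p) :
    (p : ℤ) ^ 2 ∣ ∑ i ∈ Finset.range p, (i : ℤ) ^ m ↔ padicValRat p (bernoulli m) ≠ 0 := by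
  have hp0 : (p : ℚ) ≠ 0 := by exact_mod_cast (Fact.out : p.Prime).ne_zero
  have hB : bernoulli m ≠ 0 := by
    obtain ⟨k, rfl⟩ := hme
    rw [← two_mul]
    exact bernoulli_two_mul_ne_zero (by omega)
  rw [← intCast_div_mem_integer_iff, ← div_mem_integer_iff hB (bernoulli_mem_integer (by omega))]
  have h := sum_range_pow p m
  rw [Finset.sum_range_succ] at h
  have hz : (∑ i ∈ Finset.range m,
      bernoulli i * ((m + 1).choose i) * (p : ℚ) ^ (m - 1 - i) * ((m + 1 : ℕ) : ℚ)⁻¹) ∈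
      (Rat.padicValuation p).integer := by
    refine sum_mem fun i hi => ?_
    have := Finset.mem_range.1 hi
    refine mul_mem (mul_mem (mul_mem (bernoulli_mem_integer (by omega)) (natCast_mem _ _))
      (pow_mem (natCast_mem _ _) _)) (natCast_inv_mem_integer (by omega)
      (fun hd => absurd (Nat.le_of_dvd (by omega) hd) (by omega)))
  -- In Faulhaber's formula the terms with `i < m` carry `p ^ (m + 1 - i)`, of exponent at least 2;
  -- only `p B_m` does not.
  have hs : ((∑ i ∈ Finset.range p, (i : ℤ) ^ m : ℤ) : ℚ) / p ^ 2 = bernoulli m / p +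
      ∑ i ∈ Finset.range m,
        bernoulli i * ((m + 1).choose i) * (p : ℚ) ^ (m - 1 - i) * ((m + 1 : ℕ) : ℚ)⁻¹ := by
    push_cast
    rw [h, add_div, add_comm, Finset.sum_div]
    congr 1
    · rw [Nat.choose_succ_self_right, Nat.add_sub_cancel_left]
      have : (m : ℚ) + 1 ≠ 0 := by positivity
      push_cast
      field_simp
    · refine Finset.sum_congr rfl fun i hi => ?_
      have := Finset.mem_range.1 hi
      rw [show m + 1 - i = (m - 1 - i) + 2 by omega, pow_add]
      have : (m : ℚ) + 1 ≠ 0 := by positivity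
      field_simp
  rw [hs]
  exact add_mem_cancel_right hz

end

/-! ### Reflection and the odd case -/

theorem exists_eval_eq_of_pow_four (f : ℤ[X]) (x : ℤ) :
    ∃ z, f.eval x = f.coeff 0 + x * f.coeff 1 + x ^ 2 * f.coeff 2 + x ^ 3 * f.coeff 3 +
      x ^ 4 * z := by
  refine ⟨f.divX.divX.divX.divX.eval x, ?_⟩
  have h : ∀ g : ℤ[X], g.eval x = g.coeff 0 + x * g.divX.eval x := fun g => by
    conv_lhs => rw [← divX_mul_X_add g]
    simp
    ring
  rw [h f, h f.divX, h f.divX.divX, h f.divX.divX.divX]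
  simp only [coeff_divX]
  ring

/-- The polynomial `(X + 1) ⋯ (X + N - 1)` is, up to sign, invariant under `X ↦ - X - N`. -/
theorem ascPochhammer_comp_reflect (N : ℕ) :
    ((((ascPochhammer ℤ N).comp (X + 1)).comp (-X)).comp (X + C ((N : ℤ) + 1))) =
      (-1) ^ N * (ascPochhammer ℤ N).comp (X + 1) := by
  rw [ascPochhammer_eq_prod]
  simp only [prod_comp, add_comp, X_comp, C_comp, neg_comp, one_comp]
  rw [← Finset.prod_range_reflect]
  have h : ((-1 : ℤ[X]) ^ N) = ∏ _i ∈ Finset.range N, (-1) := by simp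
  rw [h, ← Finset.prod_mul_distrib]
  refine Finset.prod_congr rfl fun i hi => ?_
  have hi' := Finset.mem_range.1 hi
  rw [Nat.sub_sub, Nat.cast_sub (by omega)]
  simp
  ring

/-- The Stirling numbers in odd codegree in terms of those of larger lower index. -/
theorem exists_two_mul_stirlingFirst_eq {N M : ℕ} (hM : 1 ≤ M) (hMN : M ≤ N)
    (hodd : Odd (N - M)) :
    ∃ z : ℤ, 2 * (Nat.stirlingFirst N M : ℤ) =
      M * N * Nat.stirlingFirst N (M + 1) -
      (M + 1).choose 2 * N ^ 2 * Nat.stirlingFirst N (M + 2) +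
      (M + 2).choose 3 * N ^ 3 * Nat.stirlingFirst N (M + 3) + N ^ 4 * z := by
  obtain ⟨n, rfl⟩ := Nat.exists_eq_add_of_le' (hM.trans hMN)
  obtain ⟨i, rfl⟩ := Nat.exists_eq_add_of_le' hM
  have hR : ∀ m, ((ascPochhammer ℤ n).comp (X + 1)).coeff m = Nat.stirlingFirst (n + 1) (m + 1) := by
    intro m
    rw [← coeff_ascPochhammer ℤ, ascPochhammer_succ_left, coeff_X_mul]
  have h : coeff _ i = coeff _ i := congrArg (fun f => coeff f i) (ascPochhammer_comp_reflect n)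
  have hneg : ∀ (f : ℤ[X]) m, (f.comp (-X)).coeff m = (-1) ^ m * f.coeff m := fun f m => by
    have := comp_C_mul_X_coeff (r := (-1 : ℤ)) (p := f) (n := m)
    simpa [mul_comm] using this
  rw [← taylor_apply, taylor_coeff] at h
  obtain ⟨z, hz⟩ := exists_eval_eq_of_pow_four
    (hasseDeriv i (((ascPochhammer ℤ n).comp (X + 1)).comp (-X))) ((n : ℤ) + 1)
  rw [hz] at h
  simp only [hasseDeriv_coeff, hneg, hR] at h
  rw [show ((-1 : ℤ[X]) ^ n) = C ((-1) ^ n) by simp, coeff_C_mul, hR] at h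
  -- Odd codegree gives the two copies of `s(N, M)` opposite signs on the two sides, so they combine
  -- to `2 s(N, M)` instead of cancelling.
  have hs : ((-1 : ℤ)) ^ n = - (-1) ^ i := by
    obtain ⟨u, hu⟩ := hodd
    rw [show n = i + 2 * u + 1 by omega, pow_succ, pow_add, pow_mul]
    simp
  have hsq : ((-1 : ℤ) ^ i) * (-1) ^ i = 1 := by rw [← mul_pow]; simp
  have c1 : (1 + i).choose i = i + 1 := by rw [add_comm, Nat.choose_succ_self_right]
  have c2 : (2 + i).choose i = (i + 1 + 1).choose 2 := by
    rw [add_comm]; exact Nat.choose_symm_of_eq_add (by omega)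
  have c3 : (3 + i).choose i = (i + 1 + 2).choose 3 := by
    rw [add_comm]; exact Nat.choose_symm_of_eq_add (by omega)
  rw [hs, c1, c2, c3] at h
  simp only [add_zero, pow_add, add_comm _ i] at h
  refine ⟨-(-1) ^ i * z, ?_⟩
  push_cast at h ⊢
  rw [show i + 1 + 3 = i + 3 + 1 by ring, show i + 1 + 2 = i + 2 + 1 by ring]
  rw [show i + 1 + 2 = i + 2 + 1 by ring] at h
  rw [Nat.choose_self, Nat.cast_one] at h
  generalize ((-1 : ℤ) ^ i) = e at *
  linear_combination e * h - hsq * (2 * Nat.stirlingFirst (n + 1) (i + 1) -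
    (i + 1) * (n + 1) * Nat.stirlingFirst (n + 1) (i + 1 + 1) +
    (n + 1) ^ 2 * (i + 1 + 1).choose 2 * Nat.stirlingFirst (n + 1) (i + 2 + 1) -
    (n + 1) ^ 3 * (i + 2 + 1).choose 3 * Nat.stirlingFirst (n + 1) (i + 3 + 1))

/-- With `e = v_p(k)`, the leading term of the reflection formula is `p ^ (e + 1)` times a unit
times `s(N, N-k+1)`. All other terms are divisible by `p ^ (e + 3)`, hence `r ≤ 2`. -/
theorem pow_dvd_stirlingFirst_odd_iff {p a k r : ℕ} (hp : p.Prime) (hp5 : 5 ≤ p) (ha : 1 ≤ a)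
    (hap : a < p) (hk3 : 3 ≤ k) (hk : k < a * p) (hodd : Odd k) (hr : r ≤ 2) :
    p ^ (padicValNat p k + 1 + r) ∣ Nat.stirlingFirst (a * p) (a * p - k) ↔
      p ^ r ∣ Nat.stirlingFirst (a * p) (a * p - (k - 1)) := by
  have := Fact.mk hp
  set N := a * p with hN
  obtain ⟨M, hM⟩ : ∃ M, N = M + k := ⟨N - k, by omega⟩
  rw [show N - (k - 1) = M + 1 by omega, show N - k = M by omega]
  obtain ⟨z, hz⟩ := exists_two_mul_stirlingFirst_eq (N := N) (M := M) (by omega) (by omega)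
    (by rwa [show N - M = k by omega])
  have h2 : p ∣ Nat.stirlingFirst N (M + 2) := by
    have hnd : ¬ (p - 1) ∣ k - 2 := fun hd => by
      have he : Even (p - 1) := by
        obtain ⟨u, hu⟩ := hp.odd_of_ne_two (by omega)
        exact ⟨u, by omega⟩
      have : Even (k - 2) := (even_iff_two_dvd.1 he).trans hd |> even_iff_two_dvd.2
      obtain ⟨u, hu⟩ := this
      obtain ⟨w, hw⟩ := hodd
      omega
    have := dvd_stirlingFirst (a := a) hp hnd (by omega)
    rwa [show a * p - (k - 2) = M + 2 by omega] at this
  have hcop : ∀ c, 1 ≤ c → c < p → ∀ i, Nat.Coprime (p ^ i) c := fun c h1 h2 i =>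
    Nat.Coprime.pow_left _ ((hp.coprime_iff_not_dvd).2
      fun hd => absurd (Nat.le_of_dvd h1 hd) (by omega))
  -- `N - k` and `k` have the same valuation: if `p ∣ k`, then both `k / p` and `a - k / p` lie
  -- strictly between 0 and `p`.
  obtain ⟨M', hM', hMp⟩ : ∃ M', M = p ^ padicValNat p k * M' ∧ ¬ p ∣ M' := by
    by_cases hpk : p ∣ k
    · obtain ⟨k', rfl⟩ := hpk
      have hk' : k' < a := by
        rw [hN, mul_comm] at hk
        exact lt_of_mul_lt_mul_right hk (Nat.zero_le p)
      have hk0 : k' ≠ 0 := by rintro rfl; omega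
      have hv : padicValNat p (p * k') = 1 := by
        rw [padicValNat.mul hp.ne_zero hk0, padicValNat_self,
          padicValNat.eq_zero_of_not_dvd fun hd => absurd (Nat.le_of_dvd (by omega) hd) (by omega)]
      refine ⟨a - k', ?_, fun hd => absurd (Nat.le_of_dvd (by omega) hd) (by omega)⟩
      rw [hv, pow_one, Nat.mul_sub, mul_comm p a]
      omega
    · refine ⟨M, by rw [padicValNat.eq_zero_of_not_dvd hpk, pow_zero, one_mul], fun hd => hpk ?_⟩
      rw [← Nat.dvd_add_right hd, ← hM]
      exact Dvd.intro_left a rfl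
  have he1 : padicValNat p k ≤ 1 := by
    by_contra! h
    have h1 : p ^ 2 ≤ k := Nat.le_of_dvd (by omega) ((pow_dvd_pow p h).trans pow_padicValNat_dvd)
    have h2 : a * p ≤ p * p := Nat.mul_le_mul_right _ hap.le
    rw [sq] at h1
    omega
  set e := padicValNat p k with he
  have hc2 : p ^ e ∣ (M + 1).choose 2 := by
    refine (hcop 2 (by omega) (by omega) e).dvd_of_dvd_mul_right ?_
    rw [← Nat.add_one_mul_choose_eq M 1, Nat.choose_one_right]
    exact (Dvd.intro _ hM'.symm).mul_left _
  have hc3 : p ^ e ∣ (M + 2).choose 3 := by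
    refine (hcop 3 (by omega) (by omega) e).dvd_of_dvd_mul_right ?_
    rw [← Nat.add_one_mul_choose_eq (M + 1) 2]
    exact hc2.mul_left _
  have hNZ : (N : ℤ) = a * p := by rw [hN]; push_cast; ring
  obtain ⟨c2, hc2⟩ := hc2
  obtain ⟨c3, hc3⟩ := hc3
  obtain ⟨s2, hs2⟩ := h2
  -- Since `e ≤ 1`, the remainder's `p ^ 4` absorbs `p ^ (e + 3)`, with cofactor `p ^ d`.
  obtain ⟨d, hd⟩ := Nat.exists_eq_add_of_le he1
  have hmain : ∃ y : ℤ, 2 * (Nat.stirlingFirst N M : ℤ) =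
      (p : ℤ) ^ (e + 1) * ((M' * a : ℕ) * Nat.stirlingFirst N (M + 1)) + p ^ (e + 3) * y := by
    refine ⟨-(c2 * a ^ 2 * s2) + c3 * a ^ 3 * Nat.stirlingFirst N (M + 3) + p ^ d * a ^ 4 * z, ?_⟩
    rw [hz, hc2, hc3, hs2, hNZ]
    nth_rewrite 1 [hM']
    have hpd : (p : ℤ) = p ^ e * p ^ d := by rw [← pow_add, ← hd, pow_one]
    push_cast
    have : (p : ℤ) ^ 4 = p ^ (e + 3) * p ^ d := by
      rw [pow_add, mul_right_comm, ← hpd]; ring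
    linear_combination (a : ℤ) ^ 4 * z * this
  obtain ⟨y, hy⟩ := hmain
  have hp0 : (p : ℤ) ^ (e + 1) ≠ 0 := pow_ne_zero _ (by exact_mod_cast hp.ne_zero)
  have hcM : Nat.Coprime (p ^ r) (M' * a) := Nat.Coprime.mul_right
    (Nat.Coprime.pow_left _ ((hp.coprime_iff_not_dvd).2 hMp)) (hcop a ha hap r)
  have hy' : (p : ℤ) ^ (e + 1 + r) ∣ p ^ (e + 3) * y :=
    (pow_dvd_pow _ (by omega)).mul_right _
  rw [← (hcop 2 (by omega) (by omega) (e + 1 + r)).dvd_mul_left, ← hcM.dvd_mul_left,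
    ← Int.natCast_dvd_natCast, ← Int.natCast_dvd_natCast]
  push_cast
  push_cast at hy
  rw [hy, dvd_add_left hy', pow_add, mul_dvd_mul_iff_left hp0]

/-- The even case of the mod `p ^ 2` criterion. -/
theorem sq_dvd_stirlingFirst_iff_bernoulli {p a k : ℕ} (hp : p.Prime) (hp5 : 5 ≤ p) (ha : 1 ≤ a)
    (hap : a < p) (hke : Even k) (hk : ¬ (p - 1) ∣ k) (hka : k < a * (p - 1)) :
    p ^ 2 ∣ Nat.stirlingFirst (a * p) (a * p - k) ↔
      padicValRat p (bernoulli (k % (p - 1))) ≠ 0 := by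
  have := Fact.mk hp
  obtain ⟨u, hu⟩ := hp.odd_of_ne_two (by omega)
  obtain ⟨v, hv⟩ := hke
  have hlt : k % (p - 1) < p - 1 := Nat.mod_lt _ (by omega)
  have h0 : k % (p - 1) ≠ 0 := fun h => hk (Nat.dvd_of_mod_eq_zero h)
  have hmod : Even (k % (p - 1)) := by
    rw [Nat.even_iff, Nat.mod_mod_of_dvd _ ⟨u, by omega⟩]
    omega
  have hle : k % (p - 1) + 3 ≤ p := by
    obtain ⟨w, hw⟩ := hmod
    omega
  rw [sq_dvd_stirlingFirst_iff hp (by omega) ha hap ⟨v, hv⟩ hk hka,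
    sq_dvd_stirlingFirst_iff_sq_dvd_sum_pow hp (by omega) hlt, sq_dvd_sum_pow_iff h0 hmod hle]

end StirlingValuation

/-! ### Assembling the three statements -/

open StirlingValuation in
theorem theorem1p1 (p a k : ℕ) (hp : p.Prime) (hp5 : 5 ≤ p) (ha1 : 1 ≤ a) (hap : a ≤ p - 1)
    (hk2 : 2 ≤ k) (hk : k ≤ a * p - 2) :
    (k ≡ StirlingValuation.parity k [MOD (p - 1)] →
      padicValNat p (Nat.stirlingFirst (a * p) (a * p - k)) =
        (padicValNat p k + 1) * StirlingValuation.parity k) ∧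
    (k ≤ a * (p - 1) - 1 → ¬ k ≡ StirlingValuation.parity k [MOD (p - 1)] →
      (padicValNat p k + 1) * StirlingValuation.parity k + 1 ≤
        padicValNat p (Nat.stirlingFirst (a * p) (a * p - k)) ∧
      (padicValNat p (Nat.stirlingFirst (a * p) (a * p - k)) =
          (padicValNat p k + 1) * StirlingValuation.parity k + 1 ↔
        padicValRat p (bernoulli (2 * (StirlingValuation.residue p k / 2))) = 0) ∧
      (StirlingValuation.IsRegularPrime p →
        padicValNat p (Nat.stirlingFirst (a * p) (a * p - k)) =
          (padicValNat p k + 1) * StirlingValuation.parity k + 1)) ∧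
    (4 ≤ a → a * (p - 1) + 2 ≤ k →
      (a : ℤ) + (k : ℤ) - (a : ℤ) * (p : ℤ) ≤
        (padicValNat p (Nat.stirlingFirst (a * p) (a * p - k)) : ℤ)) := by
  have := Fact.mk hp
  have hap' : a < p := by omega
  have hpap : p ≤ a * p := Nat.le_mul_of_pos_left p ha1
  have hsub : a * (p - 1) = a * p - a := by rw [Nat.mul_sub, mul_one]
  have hs0 : Nat.stirlingFirst (a * p) (a * p - k) ≠ 0 :=
    (stirlingFirst_pos (by omega) (by omega)).ne'
  have hval : ∀ m, p ^ m ∣ Nat.stirlingFirst (a * p) (a * p - k) ↔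
      m ≤ padicValNat p (Nat.stirlingFirst (a * p) (a * p - k)) :=
    fun m => padicValNat_dvd_iff_le hs0
  obtain ⟨u, hu⟩ := hp.odd_of_ne_two (by omega)
  obtain ⟨l, hl, hle, hl2⟩ : ∃ l, k = l + parity k ∧ Even l ∧ 2 ≤ l := by
    unfold parity
    split_ifs with h
    · exact ⟨k, rfl, h, hk2⟩
    · obtain ⟨w, hw⟩ := Nat.not_even_iff_odd.1 h
      exact ⟨2 * w, hw, even_two_mul w, by omega⟩
  have hpar : parity k ≤ 1 := by
    unfold parity
    split_ifs <;> omega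
  -- This treats both parities at once: `l` is the even one of `k` and `k - 1`.
  have hiff : ∀ r ≤ 2, p ^ ((padicValNat p k + 1) * parity k + r) ∣
      Nat.stirlingFirst (a * p) (a * p - k) ↔
      p ^ r ∣ Nat.stirlingFirst (a * p) (a * p - l) := by
    intro r hr
    by_cases h : Even k
    · have h0 : parity k = 0 := if_pos h
      rw [h0] at hl ⊢
      rw [mul_zero, zero_add, hl, add_zero]
    · have h0 : parity k = 1 := if_neg h
      rw [h0] at hl ⊢
      rw [mul_one, pow_dvd_stirlingFirst_odd_iff hp hp5 ha1 hap' (by omega) (by omega)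
        (Nat.not_even_iff_odd.1 h) hr, show k - 1 = l by omega]
  have hmod : k ≡ parity k [MOD (p - 1)] ↔ (p - 1) ∣ l := by
    rw [Nat.ModEq.comm, Nat.modEq_iff_dvd' (by omega), show k - parity k = l by omega]
  rw [hmod]
  set c := (padicValNat p k + 1) * parity k with hc
  refine ⟨fun hd => ?_, fun hka hd => ?_, fun _ hka => ?_⟩
  · have hla : l ≤ a * (p - 1) := by
      obtain ⟨j, hj⟩ := hd
      rw [hj, mul_comm (p - 1)]
      refine Nat.mul_le_mul_right _ ?_
      -- The next multiple, `(a + 1) (p - 1) = ap + (p - 1 - a)`, is at least `ap` and so exceeds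
      -- `l`.
      by_contra! hlt
      have : (a + 1) * (p - 1) ≤ j * (p - 1) := Nat.mul_le_mul_right _ hlt
      rw [add_mul, hsub, mul_comm j, ← hj] at this
      have : a ≤ a * p := Nat.le_mul_of_pos_right a (by omega)
      omega
    have hnd := not_dvd_stirlingFirst hp hap' hd hla
    have h0 := (hval (c + 0)).1 ((hiff 0 (by omega)).2 (by simp))
    have h1 := (hval (c + 1)).not.1 fun h => hnd (by simpa using (hiff 1 (by omega)).1 h)
    omega
  · have hla : l < a * (p - 1) := by
      have : 1 * 4 ≤ a * (p - 1) := Nat.mul_le_mul ha1 (by omega)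
      omega
    have hres : 2 * (residue p k / 2) = l % (p - 1) := by
      have hev : Even (l % (p - 1)) := by
        rw [Nat.even_iff, Nat.mod_mod_of_dvd _ ⟨u, by omega⟩]
        exact Nat.even_iff.1 hle
      have hlt : l % (p - 1) < p - 1 := Nat.mod_lt _ (by omega)
      obtain ⟨w, hw⟩ := hev
      -- No wrap-around occurs: the even residue of `l` is at most `p - 3`.
      have : residue p k = l % (p - 1) + parity k := by
        unfold residue
        conv_lhs => rw [hl]
        rw [Nat.add_mod, Nat.mod_eq_of_lt (a := parity k) (by omega), Nat.mod_eq_of_lt (by omega)]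
      omega
    have h1 := (hval (c + 1)).1 ((hiff 1 (by omega)).2
      (by simpa using dvd_stirlingFirst hp hd (by omega)))
    have h2 := ((hval (c + 2)).symm.trans (hiff 2 le_rfl)).trans
      (sq_dvd_stirlingFirst_iff_bernoulli hp hp5 ha1 hap' hle hd hla)
    have h3 : padicValNat p (Nat.stirlingFirst (a * p) (a * p - k)) = c + 1 ↔
        padicValRat p (bernoulli (2 * (residue p k / 2))) = 0 := by
      rw [hres, ← not_iff_not, ← ne_eq (padicValRat _ _), ← h2]
      omega
    refine ⟨h1, h3, fun hreg => h3.2 (hreg.2 _ (even_two_mul _) ?_ ?_)⟩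
    · have : l % (p - 1) ≠ 0 := fun h => hd (Nat.dvd_of_mod_eq_zero h)
      omega
    · have : l % (p - 1) < p - 1 := Nat.mod_lt _ (by omega)
      omega
  · have hdvd := pow_sub_dvd_stirlingFirst hp.one_le (a := a) (m := a * p - k) (by omega)
    rw [hval] at hdvd
    have hcast : ((a * p : ℕ) : ℤ) = a * p := Nat.cast_mul a p
    omega
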